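/- A continued fraction (CF) here is a pair of sequences of rational numbers $(a_n,b_n)_{n\ge0}$, standing for $a_0+b_0/(a_1+b_1/(a_2+b_2/(a_3+\cdots)))$, with $b_n\ne0$ for all $n$ and at most finitely many $a_n$ equal to $0$. Let $p_n/q_n=a_0+b_0/(a_1+\cdots+b_{n-1}/a_n)$ be its convergents, where $p_0=a_0$, $q_0=1$, $p_1=a_1a_0+b_0$, $q_1=a_1$, and $p_n=a_np_{n-1}+b_{n-1}p_{n-2}$, $q_n=a_nq_{n-1}+b_{n-1}q_{n-2}$ for $n\ge2$. The CF converges to $z\in\mathbb R$ if $q_n\ne0$ for all large $n$ and $p_n/q_n\to z$. A pair of polynomials $(A,B)$ with rational coefficients represents $z$ if some CF with $a_n=A(n)$ and $b_n=B(n)$ for all sufficiently large $n$ converges to $z$. Let $u,v,w,k$ be nonnegative integers and put $$A(n)=2n^2+(3u+v+w-2)n+k^2+u^2+uk+vk+wk+uv+uw+vw+k-u+1,$$ $$B(n)=-n(n+u)(n+u+v)(n+u+w).$$ Then: 1. The pair $(A,B)$ represents $\pi^2$. 2. Let $(a_n,b_n)_{n\ge0}$ be any convergent CF with $a_n=A(n)$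 and $b_n=B(n)$ for all sufficiently large $n$, and let $z$ be its limit. Then $z=(\alpha\pi^2+\beta)/(\gamma\pi^2+\delta)$ for some integers $\alpha,\beta,\gamma,\delta$ with $\alpha\delta-\beta\gamma\ne0$ and $\gamma\pi^2+\delta\neq0$, and there is a constant $C\ne0$ (depending on the CF) such that $$z-\frac{p_n}{q_n}\sim\frac{C}{n^{u+v+w+2k+1}}\qquad(n\to\infty).$$ -/

import Mathlib

/-- A continued fraction `a₀ + b₀ / (a₁ + b₁ / (a₂ + b₂ / (a₃ + ⋯)))` with rational terms, where all
`bₙ` are nonzero and at most finitely many `aₙ` vanish. -/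
structure RatCF where
  a : ℕ → ℚ
  b : ℕ → ℚ
  b_ne_zero : ∀ n, b n ≠ 0
  a_ne_zero : ∀ᶠ n in Filter.atTop, a n ≠ 0

namespace RatCF

/-- The continued fraction as a generalized continued fraction of Mathlib, whose head term is `a₀`
and whose sequence of (numerator, denominator) pairs is `(b₀, a₁), (b₁, a₂), …`. -/
def toGenContFract (c : RatCF) : GenContFract ℚ :=
  ⟨c.a 0, Stream'.Seq.ofStream fun n => ⟨c.b n, c.a (n + 1)⟩⟩

/-- The numerator `pₙ` of the `n`-th convergent `a₀ + b₀ / (a₁ + ⋯ + bₙ₋₁ / aₙ)`. -/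
def p (c : RatCF) (n : ℕ) : ℚ := c.toGenContFract.nums n

/-- The denominator `qₙ` of the `n`-th convergent `a₀ + b₀ / (a₁ + ⋯ + bₙ₋₁ / aₙ)`. -/
def q (c : RatCF) (n : ℕ) : ℚ := c.toGenContFract.dens n

theorem p_zero (c : RatCF) : c.p 0 = c.a 0 := rfl

theorem q_zero (c : RatCF) : c.q 0 = 1 := rfl

theorem p_one (c : RatCF) : c.p 1 = c.a 1 * c.a 0 + c.b 0 * 1 := rfl

theorem q_one (c : RatCF) : c.q 1 = c.a 1 * 1 + c.b 0 * 0 := rfl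

theorem p_add_two (c : RatCF) (n : ℕ) :
    c.p (n + 2) = c.a (n + 2) * c.p (n + 1) + c.b (n + 1) * c.p n := rfl

theorem q_add_two (c : RatCF) (n : ℕ) :
    c.q (n + 2) = c.a (n + 2) * c.q (n + 1) + c.b (n + 1) * c.q n := rfl

/-- The continued fraction converges to `z`: the convergents `pₙ / qₙ` are defined for all large `n`
and tend to `z`. -/
def ConvergesTo (c : RatCF) (z : ℝ) : Prop :=
  (∀ᶠ n in Filter.atTop, c.q n ≠ 0) ∧
    Filter.Tendsto (fun n : ℕ => (c.p n : ℝ) / (c.q n : ℝ)) Filter.atTop (nhds z)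

/-- The error `z - pₙ / qₙ` is asymptotic to `C / n ^ P` for some nonzero constant `C`. -/
def HasSpeed (c : RatCF) (z : ℝ) (P : ℕ) : Prop :=
  ∃ C : ℝ, C ≠ 0 ∧
    Asymptotics.IsEquivalent Filter.atTop
      (fun n : ℕ => z - (c.p n : ℝ) / (c.q n : ℝ)) (fun n : ℕ => C / (n : ℝ) ^ P)

/-- The terms are given by the polynomials `A` and `B` for all large `n`:
`aₙ = A(n)` and `bₙ = B(n)`. -/
def HasTail (c : RatCF) (A B : Polynomial ℚ) : Prop :=
  ∀ᶠ n : ℕ in Filter.atTop, c.a n = A.eval (n : ℚ) ∧ c.b n = B.eval (n : ℚ)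

end RatCF

/-- The pair of polynomials `(A, B)` represents `z`: some continued fraction with `aₙ = A(n)` and
`bₙ = B(n)` for all large `n` converges to `z`. -/
def Represents (A B : Polynomial ℚ) (z : ℝ) : Prop :=
  ∃ c : RatCF, c.HasTail A B ∧ c.ConvergesTo z

/-- `z'` is the image of `z` under a Möbius transformation with integer coefficients and nonzero
determinant. -/
def IsMobiusImage (z z' : ℝ) : Prop :=
  ∃ α β γ δ : ℤ, α * δ - β * γ ≠ 0 ∧ (γ : ℝ) * z + δ ≠ 0 ∧
    z' = ((α : ℝ) * z + β) / ((γ : ℝ) * z + δ)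

/-- `A(n) = 2n² + (3u+v+w-2)n + k²+u²+uk+vk+wk+uv+uw+vw+k-u+1`. -/
noncomputable def familyA (u v w k : ℕ) : Polynomial ℚ :=
  2 * Polynomial.X ^ 2 + Polynomial.C (3 * u + v + w - 2 : ℚ) * Polynomial.X +
    Polynomial.C (k ^ 2 + u ^ 2 + u * k + v * k + w * k + u * v + u * w + v * w + k - u + 1 : ℚ)

/-- `B(n) = -n(n+u)(n+u+v)(n+u+w)`. -/
noncomputable def familyB (u v w : ℕ) : Polynomial ℚ :=
  -(Polynomial.X * (Polynomial.X + Polynomial.C (u : ℚ)) *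
    (Polynomial.X + Polynomial.C (u + v : ℚ)) * (Polynomial.X + Polynomial.C (u + w : ℚ)))

open Filter Topology

/-! Dividing the recurrence of `p` and `q` by `hahnFactor` gives a second-order difference equation
of Hahn type with eigenvalue `k (k + u + v + w + 1)`. Everything reduces to two rational solutions
`P`, `Q` of it with nonzero Casoratian, `Q n` of order `n ^ k` and `P n / Q n → π²`.

For `k = 0` constants are solutions, and the differences of any other solution are multiples of
`invProd 0 (u + v) u w`. Partial fractions show that the sum of this series is `r π² + r'` with `r`,
`r'` rational, and a sign argument gives `r ≠ 0`, so an affine change of the partial sums yields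
`P`, with `Q = 1`. For the step, differences of solutions for `(u, v, w, k + 1)` solve the equation
for `(u, v + 1, w + 1, k)`; as the eigenvalue is nonzero, this map can be inverted
(`backwardShift`), and the inverse preserves the limit `π²`.

The Casoratian is a constant times `invProd 0 (u + v) u w n`, of order `n ^ -(u + v + w + 2)`. Hence
`P n / Q n` has increments of order `n ^ -(u + v + w + 2 k + 2)`, and Stolz–Cesàro gives the speed.
Any continued fraction with this tail has `p`, `q` equal to `hahnFactor` times independent rational
combinations of `P`, `Q`, so its convergents are a Möbius image of `P n / Q n`. -/

/-! ### Asymptotics of sequences from their increments -/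

theorem tendsto_ratio_succ_nat :
    Tendsto (fun n : ℕ => (n : ℝ) / ((n : ℝ) + 1)) atTop (𝓝 1) :=
  tendsto_natCast_div_add_atTop (1 : ℝ)

/-- `n (1 - (n / (n + 1)) ^ M) → M`. -/
theorem tendsto_mul_one_sub_ratio_pow (M : ℕ) :
    Tendsto (fun n : ℕ => (n : ℝ) * (1 - ((n : ℝ) / ((n : ℝ) + 1)) ^ M)) atTop (𝓝 (M : ℝ)) := by
  have hr := tendsto_ratio_succ_nat
  have hs : Tendsto (fun n : ℕ => ((n : ℝ) / ((n : ℝ) + 1)) *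
      ∑ i ∈ Finset.range M, ((n : ℝ) / ((n : ℝ) + 1)) ^ i) atTop (𝓝 (M : ℝ)) := by
    have := hr.mul (tendsto_finsetSum (Finset.range M) fun i _ => hr.pow i)
    simpa using this
  refine hs.congr fun n => ?_
  rw [← mul_neg_geom_sum]
  have : (n : ℝ) + 1 ≠ 0 := by positivity
  field_simp
  ring

/-- A null sequence whose increments are `o` of those of a decreasing null sequence is itself
dominated by that sequence. -/
theorem abs_le_mul_of_abs_sub_le {e b : ℕ → ℝ} {ε : ℝ} {N : ℕ}
    (h : ∀ n ≥ N, |e (n + 1) - e n| ≤ ε * (b n - b (n + 1)))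
    (he : Tendsto e atTop (𝓝 0)) (hb : Tendsto b atTop (𝓝 0)) {n : ℕ} (hn : N ≤ n) :
    |e n| ≤ ε * b n := by
  have key : ∀ f : ℕ → ℝ, (∀ n ≥ N, f (n + 1) ≤ f n) → Tendsto f atTop (𝓝 0) → 0 ≤ f n := by
    intro f hf hf0
    have hanti : Antitone fun m => f (n + m) :=
      antitone_nat_of_succ_le fun m => hf (n + m) (by omega)
    have := hanti.le_of_tendsto ((tendsto_add_atTop_iff_nat n).2 hf0 |>.congr
      fun m => by rw [add_comm]) 0
    simpa using this
  have h1 := key (fun m => ε * b m - e m)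
    (fun m hm => by have := abs_le.1 (h m hm); linarith [this.1])
    (by simpa using (hb.const_mul ε).sub he)
  have h2 := key (fun m => ε * b m + e m)
    (fun m hm => by have := abs_le.1 (h m hm); linarith [this.2])
    (by simpa using (hb.const_mul ε).add he)
  exact abs_le.2 ⟨by linarith, by linarith⟩

/-- A `0 / 0` Stolz–Cesàro theorem for powers of `1 / n`. -/
theorem tendsto_mul_pow_of_sub {ρ : ℕ → ℝ} {M : ℕ} (hM : M ≠ 0) {K : ℝ}
    (h0 : Tendsto ρ atTop (𝓝 0))
    (h : Tendsto (fun n : ℕ => (ρ (n + 1) - ρ n) * (n : ℝ) ^ (M + 1)) atTop (𝓝 K)) :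
    Tendsto (fun n : ℕ => ρ n * (n : ℝ) ^ M) atTop (𝓝 (-K / M)) := by
  have hM0 : (M : ℝ) ≠ 0 := Nat.cast_ne_zero.2 hM
  have hMpos : (0 : ℝ) < M := by positivity
  set L : ℝ := -K / M with hL
  set b : ℕ → ℝ := fun n => 1 / (n : ℝ) ^ M with hb
  have hb0 : Tendsto b atTop (𝓝 0) := by
    have := tendsto_const_div_pow (1 : ℝ) M hM
    exact this.comp tendsto_natCast_atTop_atTop
  have hdb : Tendsto (fun n : ℕ => (b n - b (n + 1)) * (n : ℝ) ^ (M + 1)) atTop (𝓝 (M : ℝ)) := by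
    refine (tendsto_mul_one_sub_ratio_pow M).congr' ?_
    filter_upwards [eventually_gt_atTop 0] with n hn
    have hn' : (n : ℝ) ≠ 0 := by positivity
    have hn1 : (n : ℝ) + 1 ≠ 0 := by positivity
    simp only [hb, div_pow]
    push_cast
    field_simp
    ring
  -- `L` satisfies `K + L M = 0`, so subtracting the model `L / n ^ M` leaves increments that are
  -- `o(1 / n ^ (M + 1))`.
  have he0 : Tendsto (fun n => ρ n - L * b n) atTop (𝓝 0) := by
    simpa using h0.sub (hb0.const_mul L)
  have hde : Tendsto (fun n : ℕ =>
      ((ρ (n + 1) - L * b (n + 1)) - (ρ n - L * b n)) * (n : ℝ) ^ (M + 1)) atTop (𝓝 0) := by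
    have := h.add (hdb.const_mul L)
    have h2 : K + L * M = 0 := by rw [hL]; field_simp; ring
    rw [h2] at this
    exact this.congr fun n => by ring
  have hlim : Tendsto (fun n : ℕ => (ρ n - L * b n) * (n : ℝ) ^ M) atTop (𝓝 0) := by
    rw [Metric.tendsto_atTop]
    intro ε hε
    have h1 : ∀ᶠ n : ℕ in atTop, |((ρ (n + 1) - L * b (n + 1)) - (ρ n - L * b n)) *
        (n : ℝ) ^ (M + 1)| < ε / 2 * (M / 2) := by
      have := (Metric.tendsto_nhds.1 hde) (ε / 2 * (M / 2)) (by positivity)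
      simpa [Real.dist_eq] using this
    have h2 : ∀ᶠ n : ℕ in atTop, (M : ℝ) / 2 < (b n - b (n + 1)) * (n : ℝ) ^ (M + 1) :=
      hdb.eventually (lt_mem_nhds (by linarith))
    obtain ⟨N, hN⟩ := eventually_atTop.1 (h1.and (h2.and (eventually_gt_atTop 0)))
    refine ⟨N, fun n hn => ?_⟩
    have hbd : |ρ n - L * b n| ≤ ε / 2 * b n := by
      refine abs_le_mul_of_abs_sub_le (e := fun n => ρ n - L * b n) (N := N) ?_ he0 hb0 hn
      intro m hm
      obtain ⟨h3, h4, h5⟩ := hN m hm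
      have hp : (0 : ℝ) < (m : ℝ) ^ (M + 1) := by positivity
      rw [abs_mul, abs_of_pos hp] at h3
      refine le_of_mul_le_mul_right ?_ hp
      have : ε / 2 * (M / 2) ≤ ε / 2 * ((b m - b (m + 1)) * (m : ℝ) ^ (M + 1)) := by gcongr
      nlinarith
    have h5 := (hN n hn).2.2
    have hp : (0 : ℝ) < (n : ℝ) ^ M := by positivity
    rw [Real.dist_eq, sub_zero, abs_mul, abs_of_pos hp]
    calc |ρ n - L * b n| * (n : ℝ) ^ M ≤ ε / 2 * b n * (n : ℝ) ^ M := by gcongr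
      _ = ε / 2 := by simp only [hb]; field_simp
      _ < ε := by linarith
  have := hlim.add_const L
  rw [zero_add] at this
  refine this.congr' ?_
  filter_upwards [eventually_gt_atTop 0] with n hn
  have hn' : (n : ℝ) ≠ 0 := by positivity
  simp only [hb]
  field_simp
  ring

/-- If the increments of `x` are asymptotic to `c n ^ k` then `x n` is asymptotic to
`c / (k + 1) * n ^ (k + 1)`. -/
theorem tendsto_div_pow_of_sub {x : ℕ → ℝ} {k : ℕ} {c : ℝ}
    (h : Tendsto (fun n : ℕ => (x (n + 1) - x n) / (n : ℝ) ^ k) atTop (𝓝 c)) :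
    Tendsto (fun n : ℕ => x n / (n : ℝ) ^ (k + 1)) atTop (𝓝 (c / (k + 1))) := by
  have hk : (k : ℝ) + 1 ≠ 0 := by positivity
  set G : ℕ → ℝ := fun n => ((n + 1 : ℕ) : ℝ) ^ (k + 1) - (n : ℝ) ^ (k + 1) with hG
  have hGsum : ∀ n, ∑ i ∈ Finset.range n, G i = (n : ℝ) ^ (k + 1) := fun n => by
    simp only [hG]
    rw [Finset.sum_range_sub (fun i : ℕ => (i : ℝ) ^ (k + 1))]
    simp
  have hGpos : ∀ n, 0 < G n := fun n => by
    simp only [hG, sub_pos]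
    gcongr
    simp
  have hGlim : Tendsto (fun n : ℕ => G n / (n : ℝ) ^ k) atTop (𝓝 ((k : ℝ) + 1)) := by
    have h1 := (tendsto_mul_one_sub_ratio_pow (k + 1)).div
      (tendsto_ratio_succ_nat.pow (k + 1)) (by simp)
    simp only [one_pow, div_one, Nat.cast_add, Nat.cast_one] at h1
    refine h1.congr' ?_
    filter_upwards [eventually_gt_atTop 0] with n hn
    have hn' : (n : ℝ) ≠ 0 := by positivity
    have hn1 : (n : ℝ) + 1 ≠ 0 := by positivity
    simp only [hG, Pi.div_apply, div_pow]
    push_cast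
    field_simp
    ring
  have hlo : (fun n => (x (n + 1) - x n) - c / (k + 1) * G n) =o[atTop] G := by
    refine (Asymptotics.isLittleO_iff_tendsto fun n hn => absurd hn (hGpos n).ne').2 ?_
    have h1 := (h.div hGlim hk).sub_const (c / (k + 1))
    rw [sub_self] at h1
    refine h1.congr' ?_
    filter_upwards [eventually_gt_atTop 0] with n hn
    have hn' : (n : ℝ) ≠ 0 := by positivity
    have := (hGpos n).ne'
    simp only [Pi.div_apply]
    field_simp
  have hsum := hlo.sum_range (fun n => (hGpos n).le) (by
    simp only [hGsum]
    exact (tendsto_pow_atTop (by omega)).comp tendsto_natCast_atTop_atTop)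
  have hxsum : ∀ n, ∑ i ∈ Finset.range n, (x (i + 1) - x i - c / (k + 1) * G i) =
      x n - x 0 - c / (k + 1) * (n : ℝ) ^ (k + 1) := fun n => by
    rw [Finset.sum_sub_distrib, ← Finset.mul_sum, Finset.sum_range_sub, hGsum]
  simp only [hGsum, hxsum] at hsum
  have h2 := hsum.tendsto_div_nhds_zero
  have h3 : Tendsto (fun n : ℕ => x 0 / (n : ℝ) ^ (k + 1)) atTop (𝓝 0) :=
    (tendsto_const_div_pow (x 0) (k + 1) (by omega)).comp tendsto_natCast_atTop_atTop
  have h4 := (h2.add h3).add_const (c / (k + 1))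
  rw [zero_add, zero_add] at h4
  refine h4.congr' ?_
  filter_upwards [eventually_gt_atTop 0] with n hn
  have hn' : (n : ℝ) ≠ 0 := by positivity
  field_simp
  ring

theorem tendsto_natCast_add_div (a : ℝ) :
    Tendsto (fun n : ℕ => ((n : ℝ) + a) / n) atTop (𝓝 1) := by
  have : Tendsto (fun n : ℕ => 1 + a / (n : ℝ)) atTop (𝓝 (1 + 0)) :=
    tendsto_const_nhds.add (tendsto_const_div_atTop_nhds_zero_nat a)
  rw [add_zero] at this
  refine this.congr' ?_
  filter_upwards [eventually_gt_atTop 0] with n hn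
  have hn' : (n : ℝ) ≠ 0 := by positivity
  field_simp

/-! ### Series of reciprocal products and their `π²` coefficient -/

/-- The summand `1 / (∏ (n + 1 + i + m) ∏ (n + 1 + j + m))`, the products being over `m ≤ a` and
`m ≤ b` respectively. -/
def invProd (i a j b n : ℕ) : ℚ :=
  1 / ((∏ m ∈ Finset.range (a + 1), ((n : ℚ) + 1 + i + m)) *
    ∏ m ∈ Finset.range (b + 1), ((n : ℚ) + 1 + j + m))

theorem prod_shift_ne_zero (i a n : ℕ) :
    ∏ m ∈ Finset.range a, ((n : ℚ) + 1 + i + m) ≠ 0 :=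
  Finset.prod_ne_zero_iff.2 fun m _ => by positivity

theorem invProd_pos (i a j b n : ℕ) : 0 < invProd i a j b n := by
  unfold invProd
  have : ∀ i a : ℕ, 0 < ∏ m ∈ Finset.range a, ((n : ℚ) + 1 + i + m) := fun i a =>
    Finset.prod_pos fun m _ => by positivity
  exact one_div_pos.2 (mul_pos (this i _) (this j _))

theorem invProd_comm (i a j b n : ℕ) : invProd i a j b n = invProd j b i a n := by
  unfold invProd
  rw [mul_comm]

theorem prod_shift_succ (i a n : ℕ) :
    ∏ m ∈ Finset.range (a + 1), ((n : ℚ) + 1 + i + m) =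
      ((n : ℚ) + 1 + i) * ∏ m ∈ Finset.range a, ((n : ℚ) + 1 + (i + 1 : ℕ) + m) := by
  rw [Finset.prod_range_succ']
  simp only [Nat.cast_zero, add_zero]
  rw [mul_comm]
  congr 1
  refine Finset.prod_congr rfl fun m _ => ?_
  push_cast
  ring

/-- Partial fractions in the two end factors of the first product, which differ by `a + 1`. This
drives the reduction to two single factors. -/
theorem invProd_succ (i a j b n : ℕ) :
    invProd i (a + 1) j b n = 1 / ((a : ℚ) + 1) *
      (invProd i a j b n - invProd (i + 1) a j b n) := by
  unfold invProd
  have e1 := prod_shift_succ i (a + 1) n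
  have e2 := Finset.prod_range_succ (fun m : ℕ => (n : ℚ) + 1 + (i + 1 : ℕ) + m) a
  have e3 := prod_shift_succ i a n
  have hX := prod_shift_ne_zero (i + 1) a n
  have hY := prod_shift_ne_zero j (b + 1) n
  rw [e1, e3, e2]
  have h1 : (n : ℚ) + 1 + i ≠ 0 := by positivity
  have h2 : (n : ℚ) + 1 + (i + 1 : ℕ) + a ≠ 0 := by positivity
  have h3 : (a : ℚ) + 1 ≠ 0 := by positivity
  field_simp
  push_cast
  ring

theorem hasSum_telescope {f : ℕ → ℝ} (hf : Antitone f) (h0 : Tendsto f atTop (𝓝 0)) (d : ℕ) :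
    HasSum (fun n => f n - f (n + d)) (∑ m ∈ Finset.range d, f m) := by
  induction d with
  | zero => simp
  | succ d ih =>
    have h1 : HasSum (fun n => f (n + d) - f (n + d + 1)) (f d) := by
      rw [hasSum_iff_tendsto_nat_of_nonneg fun n => sub_nonneg.2 (hf (Nat.le_succ _))]
      have : ∀ n, ∑ i ∈ Finset.range n, (f (i + d) - f (i + d + 1)) = f d - f (n + d) := by
        intro n
        have := Finset.sum_range_sub' (fun i => f (i + d)) n
        simp only [zero_add] at this
        rw [← this]
        exact Finset.sum_congr rfl fun i _ => by rw [add_right_comm]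
      simp only [this]
      simpa using tendsto_const_nhds.sub ((tendsto_add_atTop_iff_nat d).2 h0)
    rw [Finset.sum_range_succ]
    refine (ih.add h1).congr_fun ?_
    intro n
    simp only [← add_assoc]
    ring

theorem antitone_one_div_add (i : ℕ) : Antitone fun n : ℕ => 1 / ((n : ℝ) + 1 + i) := by
  intro m n h
  have : (m : ℝ) ≤ n := by exact_mod_cast h
  simp only
  gcongr

theorem tendsto_one_div_add (i : ℕ) :
    Tendsto (fun n : ℕ => 1 / ((n : ℝ) + 1 + i)) atTop (𝓝 0) := by
  have := (tendsto_add_atTop_iff_nat (i + 1)).2 (tendsto_one_div_atTop_nhds_zero_nat (𝕜 := ℝ))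
  refine this.congr fun n => ?_
  push_cast
  ring

/-- Two distinct linear factors: the series telescopes, so `π²` does not occur. -/
theorem hasSum_invProd_base_lt (i d : ℕ) :
    ∃ r' : ℚ, HasSum (fun n => (invProd i 0 (i + (d + 1)) 0 n : ℝ)) (r' : ℝ) := by
  refine ⟨1 / ((d : ℚ) + 1) * ∑ m ∈ Finset.range (d + 1), 1 / ((m : ℚ) + 1 + i), ?_⟩
  have h := (hasSum_telescope (antitone_one_div_add i) (tendsto_one_div_add i) (d + 1)).mul_left
    (1 / ((d : ℝ) + 1))
  push_cast
  refine h.congr_fun ?_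
  intro n
  simp only [invProd]
  push_cast
  simp only [Finset.prod_range_one, Nat.cast_zero, add_zero]
  have h1 : (n : ℝ) + 1 + i ≠ 0 := by positivity
  have h2 : (n : ℝ) + 1 + (i + (d + 1)) ≠ 0 := by positivity
  have h3 : (n : ℝ) + (d + 1) + 1 + i ≠ 0 := by positivity
  have h4 : (d : ℝ) + 1 ≠ 0 := by positivity
  field_simp
  ring

/-- A repeated factor gives a tail of `ζ(2)`, the only source of `π²`. -/
theorem hasSum_invProd_base_eq (i : ℕ) :
    ∃ r' : ℚ, HasSum (fun n => (invProd i 0 i 0 n : ℝ)) (((1 / 6 : ℚ) : ℝ) * Real.pi ^ 2 + r') := by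
  refine ⟨-∑ m ∈ Finset.range (i + 1), 1 / (m : ℚ) ^ 2, ?_⟩
  have h := (hasSum_nat_add_iff' (i + 1)).2 hasSum_zeta_two
  have e : ((1 / 6 : ℚ) : ℝ) * Real.pi ^ 2 +
      ((-∑ m ∈ Finset.range (i + 1), 1 / (m : ℚ) ^ 2 : ℚ) : ℝ) =
      Real.pi ^ 2 / 6 - ∑ m ∈ Finset.range (i + 1), 1 / (m : ℝ) ^ 2 := by
    push_cast
    ring
  rw [e]
  refine h.congr_fun ?_
  intro n
  simp only [invProd]
  push_cast
  simp only [Finset.prod_range_one, Nat.cast_zero, add_zero]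
  have h1 : (n : ℝ) + 1 + i ≠ 0 := by positivity
  have h2 : (n : ℝ) + (i + 1) ≠ 0 := by positivity
  field_simp
  ring

/-- The sum of `invProd i a j b` is `r π² + r'` with rational `r`, `r'`, where `(-1) ^ (i + j) r` is
nonnegative, and nonzero if the intervals `[i, i + a]` and `[j, j + b]` meet. -/
def InvProdSum (i a j b : ℕ) : Prop :=
  ∃ r r' : ℚ, HasSum (fun n => (invProd i a j b n : ℝ)) ((r : ℝ) * Real.pi ^ 2 + r') ∧
    0 ≤ (-1) ^ (i + j) * r ∧ (i ≤ j + b → j ≤ i + a → r ≠ 0)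

theorem InvProdSum.symm {i a j b : ℕ} (h : InvProdSum i a j b) : InvProdSum j b i a := by
  obtain ⟨r, r', h1, h2, h3⟩ := h
  refine ⟨r, r', ?_, by rwa [add_comm], fun h4 h5 => h3 h5 h4⟩
  simpa only [invProd_comm j b i a] using h1

theorem invProdSum_base (i j : ℕ) : InvProdSum i 0 j 0 := by
  have key : ∀ i d, InvProdSum i 0 (i + (d + 1)) 0 := fun i d => by
    obtain ⟨r', h⟩ := hasSum_invProd_base_lt i d
    exact ⟨0, r', by simpa using h, by simp, fun _ _ => by omega⟩
  rcases lt_trichotomy i j with h | rfl | h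
  · obtain ⟨d, rfl⟩ := Nat.exists_eq_add_of_lt h
    exact key i d
  · obtain ⟨r', h⟩ := hasSum_invProd_base_eq i
    exact ⟨1 / 6, r', h, by rw [← two_mul, pow_mul]; norm_num, fun _ _ => by norm_num⟩
  · obtain ⟨d, rfl⟩ := Nat.exists_eq_add_of_lt h
    exact (key j d).symm

/-- The new coefficient is a positive multiple of `r - s`. Since `i` and `i + 1` have opposite
parity, `r` and `-s` have the same weak sign and cannot cancel: a zero difference forces both to
vanish. -/
theorem InvProdSum.succ {i a j b : ℕ} (h : InvProdSum i a j b) (h' : InvProdSum (i + 1) a j b) :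
    InvProdSum i (a + 1) j b := by
  obtain ⟨r, r', h1, h2, h3⟩ := h
  obtain ⟨s, s', k1, k2, k3⟩ := h'
  have ha : (0 : ℚ) < 1 / ((a : ℚ) + 1) := by positivity
  have e : (-1 : ℚ) ^ (i + 1 + j) = -(-1) ^ (i + j) := by ring
  rw [e] at k2
  refine ⟨1 / ((a : ℚ) + 1) * (r - s), 1 / ((a : ℚ) + 1) * (r' - s'), ?_, ?_, ?_⟩
  · have := (h1.sub k1).mul_left (1 / ((a : ℝ) + 1))
    have e2 : ((1 / ((a : ℚ) + 1) * (r - s) : ℚ) : ℝ) * Real.pi ^ 2 +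
        ((1 / ((a : ℚ) + 1) * (r' - s') : ℚ) : ℝ) =
        1 / ((a : ℝ) + 1) * (r * Real.pi ^ 2 + r' - (s * Real.pi ^ 2 + s')) := by
      push_cast
      ring
    rw [e2]
    refine this.congr_fun ?_
    intro n
    rw [invProd_succ]
    push_cast
    ring
  · have : 0 ≤ (-1 : ℚ) ^ (i + j) * r + -(-1) ^ (i + j) * s := add_nonneg h2 k2
    have := mul_nonneg ha.le this
    linarith
  · intro h4 h5 h6
    have hrs : r = s := by
      rcases mul_eq_zero.1 h6 with h | h
      · exact absurd h ha.ne'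
      · linarith
    have hs0 : r = 0 := by
      subst hrs
      have : (-1 : ℚ) ^ (i + j) * r = 0 := by linarith
      rcases mul_eq_zero.1 this with h | h
      · exact absurd h (pow_ne_zero _ (by norm_num))
      · exact h
    -- If the intervals starting at `i` and `j` meet, so do those of one of the two summands: `[i, i
    -- + a]`, or `[i + 1, i + a + 1]` when `j = i + a + 1`.
    by_cases hj : j ≤ i + a
    · exact h3 h4 hj hs0
    · exact k3 (by omega) (by omega) (hrs ▸ hs0)

theorem invProdSum (i a j b : ℕ) : InvProdSum i a j b := by
  have h0 : ∀ a i j, InvProdSum i a j 0 := fun a => by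
    induction a with
    | zero => exact invProdSum_base
    | succ a ih => exact fun i j => (ih i j).succ (ih (i + 1) j)
  induction b generalizing j with
  | zero => exact h0 a i j
  | succ b ih => exact ((ih j).symm.succ (ih (j + 1)).symm).symm

/-- Shifting `n` changes each product only at its two ends. With `i = 0`, `a = u + v`, `j = u`, `b =
w` this is the first-order recurrence satisfied by the differences for `k = 0` and by the Casoratian
for all `k`. -/
theorem invProd_next (i a j b n : ℕ) :
    ((n : ℚ) + 2 + i + a) * ((n : ℚ) + 2 + j + b) * invProd i a j b (n + 1) =
      ((n : ℚ) + 1 + i) * ((n : ℚ) + 1 + j) * invProd i a j b n := by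
  have key : ∀ i a : ℕ, (∏ m ∈ Finset.range (a + 1), (((n + 1 : ℕ) : ℚ) + 1 + i + m)) *
      ((n : ℚ) + 1 + i) =
      (∏ m ∈ Finset.range (a + 1), ((n : ℚ) + 1 + i + m)) * ((n : ℚ) + 2 + i + a) := by
    intro i a
    have h1 := prod_shift_succ i (a + 1) n
    rw [Finset.prod_range_succ] at h1
    have h2 : ∀ m : ℕ, (n : ℚ) + 1 + (i + 1 : ℕ) + m = ((n + 1 : ℕ) : ℚ) + 1 + i + m := by
      intro m
      push_cast
      ring
    simp only [h2] at h1
    rw [mul_comm, ← h1]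
    push_cast
    ring
  unfold invProd
  have k1 := key i a
  have k2 := key j b
  have n1 := prod_shift_ne_zero i (a + 1) n
  have n2 := prod_shift_ne_zero j (b + 1) n
  have n3 := prod_shift_ne_zero i (a + 1) (n + 1)
  have n4 := prod_shift_ne_zero j (b + 1) (n + 1)
  generalize ∏ m ∈ Finset.range (a + 1), (((n + 1 : ℕ) : ℚ) + 1 + i + m) = X1 at *
  generalize ∏ m ∈ Finset.range (b + 1), (((n + 1 : ℕ) : ℚ) + 1 + j + m) = X2 at *
  generalize ∏ m ∈ Finset.range (a + 1), ((n : ℚ) + 1 + i + m) = Y1 at *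
  generalize ∏ m ∈ Finset.range (b + 1), ((n : ℚ) + 1 + j + m) = Y2 at *
  field_simp
  linear_combination (-((n : ℚ) + 1 + j) * X2) * k1 - (Y1 * (n + 2 + i + a)) * k2

theorem tendsto_prod_shift_div_pow (i a : ℕ) :
    Tendsto (fun n : ℕ => (∏ m ∈ Finset.range a, ((n : ℝ) + 1 + i + m)) / (n : ℝ) ^ a)
      atTop (𝓝 1) := by
  have := tendsto_finsetProd (Finset.range a) fun m _ =>
    tendsto_natCast_add_div (1 + (i : ℝ) + m)
  rw [Finset.prod_const_one] at this
  refine this.congr fun n => ?_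
  rw [Finset.prod_div_distrib, Finset.prod_const, Finset.card_range]
  simp only [add_assoc]

theorem tendsto_invProd_mul_pow (i a j b : ℕ) :
    Tendsto (fun n : ℕ => (invProd i a j b n : ℝ) * (n : ℝ) ^ (a + b + 2)) atTop (𝓝 1) := by
  have := ((tendsto_prod_shift_div_pow i (a + 1)).mul
    (tendsto_prod_shift_div_pow j (b + 1))).inv₀ (by norm_num)
  rw [mul_one, inv_one] at this
  refine this.congr fun n => ?_
  simp only [invProd]
  push_cast
  rw [← mul_div_mul_comm, inv_div, ← pow_add, div_mul_eq_mul_div, one_mul]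
  congr 2
  omega

/-! ### The Hahn difference equation and the speed of `P / Q` -/

/-- The recurrence of the continued fraction after division by
`∏ (j + u + v) (j + u + w)`, written as a difference equation of Hahn type. -/
def IsHahnSol (u v w k : ℕ) (x : ℕ → ℚ) : Prop :=
  ∀ n : ℕ, ((n : ℚ) + 2 + u + v) * (n + 2 + u + w) * (x (n + 2) - x (n + 1)) -
    ((n : ℚ) + 1) * (n + 1 + u) * (x (n + 1) - x n) =
      (k : ℚ) * (k + u + v + w + 1) * x (n + 1)

/-- `P`, `Q` is a basis of the rational solutions in which `Q` grows like `n ^ k` and `P / Q`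
tends to `π²`. -/
structure IsPiSqBasis (u v w k : ℕ) (P Q : ℕ → ℚ) : Prop where
  isHahnSol_left : IsHahnSol u v w k P
  isHahnSol_right : IsHahnSol u v w k Q
  casoratian_ne_zero : ∀ n, P (n + 1) * Q n - P n * Q (n + 1) ≠ 0
  right_zero_ne_zero : Q 0 ≠ 0
  -- The equation at index `-1`, where the factor `n + 1` removes the term in `Q (-1)`. It keeps `Q
  -- 0` nonzero along the induction on `k`.
  right_one : ((1 : ℚ) + u + v) * (1 + u + w) * (Q 1 - Q 0) =
    (k : ℚ) * (k + u + v + w + 1) * Q 0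
  growth : ∃ c : ℝ, c ≠ 0 ∧ Tendsto (fun n => (Q n : ℝ) / (n : ℝ) ^ k) atTop (𝓝 c)
  lim : Tendsto (fun n => (P n : ℝ) / (Q n : ℝ)) atTop (𝓝 (Real.pi ^ 2))

theorem IsHahnSol.casoratian {u v w k : ℕ} {P Q : ℕ → ℚ} (hP : IsHahnSol u v w k P)
    (hQ : IsHahnSol u v w k Q) (n : ℕ) :
    ((n : ℚ) + 2 + u + v) * (n + 2 + u + w) * (P (n + 2) * Q (n + 1) - P (n + 1) * Q (n + 2)) =
      ((n : ℚ) + 1) * (n + 1 + u) * (P (n + 1) * Q n - P n * Q (n + 1)) := by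
  linear_combination Q (n + 1) * hP n - P (n + 1) * hQ n

theorem IsHahnSol.casoratian_eq {u v w k : ℕ} {P Q : ℕ → ℚ} (hP : IsHahnSol u v w k P)
    (hQ : IsHahnSol u v w k Q) (n : ℕ) :
    (P (n + 1) * Q n - P n * Q (n + 1)) * invProd 0 (u + v) u w 0 =
      (P 1 * Q 0 - P 0 * Q 1) * invProd 0 (u + v) u w n := by
  induction n with
  | zero => simp
  | succ n ih =>
    have h1 := hP.casoratian hQ n
    have h2 := invProd_next 0 (u + v) u w n
    push_cast at h2
    have h3 : ((n : ℚ) + 2 + u + v) * (n + 2 + u + w) ≠ 0 := by positivity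
    refine mul_left_cancel₀ h3 ?_
    linear_combination invProd 0 (u + v) u w 0 * h1 + ((n : ℚ) + 1) * (n + 1 + u) * ih -
      (P 1 * Q 0 - P 0 * Q 1) * h2

namespace IsPiSqBasis

variable {u v w k : ℕ} {P Q : ℕ → ℚ}

theorem eventually_ne_zero (h : IsPiSqBasis u v w k P Q) : ∀ᶠ n in atTop, (Q n : ℝ) ≠ 0 := by
  obtain ⟨c, hc, hlim⟩ := h.growth
  filter_upwards [hlim.eventually_ne hc] with n hn h0
  exact hn (by rw [h0, zero_div])

theorem speed (h : IsPiSqBasis u v w k P Q) :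
    ∃ C : ℝ, C ≠ 0 ∧ Tendsto (fun n : ℕ => ((P n : ℝ) / Q n - Real.pi ^ 2) *
      (n : ℝ) ^ (u + v + w + 2 * k + 1)) atTop (𝓝 C) := by
  obtain ⟨c, hc, hlim⟩ := h.growth
  set W : ℝ := (((P 1 * Q 0 - P 0 * Q 1) / invProd 0 (u + v) u w 0 : ℚ) : ℝ) with hW
  have hW0 : W ≠ 0 := by
    rw [hW, Rat.cast_ne_zero]
    exact div_ne_zero (h.casoratian_ne_zero 0) (invProd_pos _ _ _ _ _).ne'
  have hcas : ∀ n, (P (n + 1) : ℝ) * Q n - P n * Q (n + 1) =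
      W * (invProd 0 (u + v) u w n : ℝ) := fun n => by
    rw [hW, ← Rat.cast_mul, ← Rat.cast_mul, ← Rat.cast_mul, ← Rat.cast_sub, Rat.cast_inj]
    have := h.isHahnSol_left.casoratian_eq h.isHahnSol_right n
    have h0 := (invProd_pos 0 (u + v) u w 0).ne'
    field_simp
    linarith
  have hlim' : Tendsto (fun n : ℕ => (Q (n + 1) : ℝ) / (n : ℝ) ^ k) atTop (𝓝 c) := by
    have h1 := ((tendsto_add_atTop_iff_nat 1).2 hlim).mul ((tendsto_natCast_add_div 1).pow k)
    rw [one_pow, mul_one] at h1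
    refine h1.congr fun n => ?_
    push_cast
    have : (n : ℝ) + 1 ≠ 0 := by positivity
    rw [div_pow]
    field_simp
  -- The increments of `P / Q` are `W * invProd / (Q (n + 1) * Q n)`, asymptotic to `W / c²` times
  -- `n ^ -(u + v + w + 2 k + 2)`; the rest is the constant `-K / M` of Stolz–Cesàro.
  refine ⟨-(W * 1 / (c * c)) / (u + v + w + 2 * k + 1 : ℕ), ?_, ?_⟩
  · refine div_ne_zero (neg_ne_zero.2 (div_ne_zero ?_ (mul_ne_zero hc hc))) ?_
    · simpa using hW0
    · exact Nat.cast_ne_zero.2 (by omega)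
  · refine tendsto_mul_pow_of_sub (by omega) ?_ ?_
    · have := h.lim.sub_const (Real.pi ^ 2)
      rwa [sub_self] at this
    · have h1 := ((tendsto_invProd_mul_pow 0 (u + v) u w).const_mul W).div
        (hlim'.mul hlim) (mul_ne_zero hc hc)
      refine h1.congr' ?_
      filter_upwards [eventually_gt_atTop 0, h.eventually_ne_zero,
        (tendsto_add_atTop_nat 1).eventually h.eventually_ne_zero] with n hn hQ hQ1
      have hn' : (n : ℝ) ≠ 0 := by positivity
      simp only [Pi.div_apply]
      have e : (P (n + 1) : ℝ) / Q (n + 1) - Real.pi ^ 2 - (P n / Q n - Real.pi ^ 2) =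
          W * (invProd 0 (u + v) u w n : ℝ) / (Q (n + 1) * Q n) := by
        rw [← hcas]
        field_simp
        ring
      rw [e]
      have e2 : u + v + w + 2 * k + 1 + 1 = (u + v + w + 2) + (k + k) := by omega
      rw [e2, pow_add (n : ℝ) (u + v + w + 2), pow_add (n : ℝ) k]
      field_simp

end IsPiSqBasis

/-! ### Existence of the basis by induction on `k` -/

/-- The case `k = 0`, in which constants are solutions. -/
theorem exists_isPiSqBasis_zero (u v w : ℕ) : ∃ P Q, IsPiSqBasis u v w 0 P Q := by
  obtain ⟨r, r', hsum, -, hr⟩ := invProdSum 0 (u + v) u w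
  have hr0 : r ≠ 0 := hr (by omega) (by omega)
  have hr1 : (r : ℝ) ≠ 0 := Rat.cast_ne_zero.2 hr0
  set P : ℕ → ℚ := fun n => (∑ i ∈ Finset.range n, invProd 0 (u + v) u w i - r') / r with hP
  have hPs : ∀ n, P (n + 1) - P n = invProd 0 (u + v) u w n / r := fun n => by
    simp only [hP, Finset.sum_range_succ]
    field_simp
    ring
  refine ⟨P, fun _ => 1, ?_, ?_, ?_, one_ne_zero, by simp, ⟨1, one_ne_zero, by simp⟩, ?_⟩
  · intro n
    have h1 := hPs n
    have h2 := hPs (n + 1)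
    have h3 := invProd_next 0 (u + v) u w n
    push_cast at h3
    rw [h1, h2]
    push_cast
    field_simp
    linear_combination h3
  · intro n
    simp
  · intro n
    rw [mul_one, mul_one, hPs]
    exact div_ne_zero (invProd_pos _ _ _ _ _).ne' hr0
  · have h1 := (hsum.tendsto_sum_nat.sub_const (r' : ℝ)).div_const (r : ℝ)
    have e : ((r : ℝ) * Real.pi ^ 2 + r' - r') / r = Real.pi ^ 2 := by
      field_simp
      ring
    rw [e] at h1
    refine h1.congr fun n => ?_
    simp [hP]

/-- The sequence with differences `d` that solves the equation for `(u, v, w, k + 1)` if `d` solves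
the one for `(u, v + 1, w + 1, k)`. -/
def backwardShift (u v w k : ℕ) (d : ℕ → ℚ) (n : ℕ) : ℚ :=
  (((2 : ℚ) + u + v) * (2 + u + w) * d 1 - (1 + u) * d 0) /
    (((k : ℚ) + 1) * (k + u + v + w + 2)) - d 0 + ∑ i ∈ Finset.range n, d i

theorem backwardShift_succ_sub (u v w k : ℕ) (d : ℕ → ℚ) (n : ℕ) :
    backwardShift u v w k d (n + 1) - backwardShift u v w k d n = d n := by
  simp only [backwardShift, Finset.sum_range_succ]
  ring

/-- The initial constant in `backwardShift` is chosen to make this true at `n = 0`; the equation for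
`d` propagates it. Since `d` is the difference sequence, the identity is exactly the Hahn equation
for the shifted sequence. -/
theorem IsHahnSol.backwardShift_succ {u v w k : ℕ} {d : ℕ → ℚ}
    (hd : IsHahnSol u (v + 1) (w + 1) k d) (n : ℕ) :
    ((k : ℚ) + 1) * (k + u + v + w + 2) * backwardShift u v w k d (n + 1) =
      ((n : ℚ) + 2 + u + v) * (n + 2 + u + w) * d (n + 1) - (n + 1) * (n + 1 + u) * d n := by
  have hl : ((k : ℚ) + 1) * (k + u + v + w + 2) ≠ 0 := by positivity
  induction n with
  | zero =>
    simp only [backwardShift, zero_add, Finset.sum_range_one]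
    field_simp
    push_cast
    ring
  | succ n ih =>
    have h1 := backwardShift_succ_sub u v w k d (n + 1)
    have h2 := hd n
    push_cast at h2 ⊢
    linear_combination ((k : ℚ) + 1) * (k + u + v + w + 2) * h1 + ih - h2

theorem IsHahnSol.backwardShift {u v w k : ℕ} {d : ℕ → ℚ}
    (hd : IsHahnSol u (v + 1) (w + 1) k d) :
    IsHahnSol u v w (k + 1) (backwardShift u v w k d) := by
  intro n
  rw [show n + 2 = n + 1 + 1 from rfl, backwardShift_succ_sub, backwardShift_succ_sub]
  have := hd.backwardShift_succ n
  push_cast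
  linear_combination -this

theorem isPiSqBasis_backwardShift {u v w k : ℕ} {P Q : ℕ → ℚ}
    (h : IsPiSqBasis u (v + 1) (w + 1) k P Q) :
    IsPiSqBasis u v w (k + 1) (backwardShift u v w k P) (backwardShift u v w k Q) := by
  have hP := h.isHahnSol_left
  have hQ := h.isHahnSol_right
  have hl : ((k : ℚ) + 1) * (k + u + v + w + 2) ≠ 0 := by positivity
  have h1 := h.right_one
  push_cast at h1
  have h0 : ((k : ℚ) + 1) * (k + u + v + w + 2) * backwardShift u v w k Q 0 =
      (1 + u + v) * (1 + u + w) * Q 0 := by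
    simp only [backwardShift, Finset.sum_range_zero]
    field_simp
    linear_combination h1
  obtain ⟨c, hc, hlim⟩ := h.growth
  have hgrow : Tendsto (fun n => (backwardShift u v w k Q n : ℝ) / (n : ℝ) ^ (k + 1)) atTop
      (𝓝 (c / (k + 1))) := by
    refine tendsto_div_pow_of_sub (hlim.congr fun n => ?_)
    rw [← Rat.cast_sub, backwardShift_succ_sub]
  have hc' : c / ((k : ℝ) + 1) ≠ 0 := div_ne_zero hc (by positivity)
  refine ⟨hP.backwardShift, hQ.backwardShift, fun n => ?_, fun h2 => ?_, ?_, ⟨_, hc', hgrow⟩, ?_⟩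
  · intro hW
    have a1 := backwardShift_succ_sub u v w k P n
    have a2 := backwardShift_succ_sub u v w k Q n
    have a3 := hP.backwardShift_succ n
    have a4 := hQ.backwardShift_succ n
    -- Eliminating the shifted values shows that the new Casoratian is a nonzero multiple of the old
    -- one.
    have a5 : ((n : ℚ) + 2 + u + v) * (n + 2 + u + w) * (P (n + 1) * Q n - P n * Q (n + 1)) = 0 := by
      linear_combination -((k : ℚ) + 1) * (k + u + v + w + 2) * hW - Q n * a3 + P n * a4 +
        ((k : ℚ) + 1) * (k + u + v + w + 2) *
          (backwardShift u v w k Q (n + 1) * a1 - backwardShift u v w k P (n + 1) * a2)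
    have a6 : ((n : ℚ) + 2 + u + v) * (n + 2 + u + w) ≠ 0 := by positivity
    exact (mul_ne_zero a6 (h.casoratian_ne_zero n)) a5
  · rw [h2, mul_zero] at h0
    have : ((1 : ℚ) + u + v) * (1 + u + w) ≠ 0 := by positivity
    exact mul_ne_zero this h.right_zero_ne_zero h0.symm
  · have := backwardShift_succ_sub u v w k Q 0
    rw [zero_add] at this
    rw [this]
    push_cast
    linear_combination -h0
  · obtain ⟨C, -, hC⟩ := h.speed
    -- The inverse shift has quadratic coefficients, so `P / Q → π²` alone would not suffice. By
    -- `speed`, `P - π² Q` is of order `n ^ -(u + v + w + k + 3)`, which absorbs the factor `n ^ 2`.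
    have hm : Tendsto (fun n : ℕ => ((P n : ℝ) - Real.pi ^ 2 * Q n) * (n : ℝ) ^ 2) atTop
        (𝓝 0) := by
      have hz : Tendsto (fun n : ℕ => 1 / (n : ℝ) ^ (u + v + w + k + 1)) atTop (𝓝 0) :=
        (tendsto_const_div_pow (1 : ℝ) _ (by omega)).comp tendsto_natCast_atTop_atTop
      have := (hC.mul hlim).mul hz
      rw [mul_zero] at this
      refine this.congr' ?_
      filter_upwards [eventually_gt_atTop 0, h.eventually_ne_zero] with n hn hQn
      have hn' : (n : ℝ) ≠ 0 := by positivity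
      have e : u + (v + 1) + (w + 1) + 2 * k + 1 = 2 + k + (u + v + w + k + 1) := by omega
      rw [e, pow_add, pow_add]
      field_simp
    have hb : ∀ a b : ℝ, Tendsto (fun n : ℕ => ((P n : ℝ) - Real.pi ^ 2 * Q n) *
        (((n : ℝ) + a) * (n + b))) atTop (𝓝 0) := fun a b => by
      have := hm.mul ((tendsto_natCast_add_div a).mul (tendsto_natCast_add_div b))
      rw [zero_mul] at this
      refine this.congr' ?_
      filter_upwards [eventually_gt_atTop 0] with n hn
      have hn' : (n : ℝ) ≠ 0 := by positivity
      field_simp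
    set l : ℝ := ((k : ℝ) + 1) * (k + u + v + w + 2) with hldef
    have hl' : l ≠ 0 := by positivity
    have hmm : Tendsto (fun n : ℕ => (backwardShift u v w k P n : ℝ) -
        Real.pi ^ 2 * backwardShift u v w k Q n) atTop (𝓝 0) := by
      rw [← tendsto_add_atTop_iff_nat 1]
      have t1 := (tendsto_add_atTop_iff_nat 1).2 (hb (1 + u + v) (1 + u + w))
      have t2 := (t1.sub (hb 1 (1 + u))).div_const l
      rw [sub_zero, zero_div] at t2
      refine t2.congr fun n => ?_
      have a3 := congrArg (Rat.cast : ℚ → ℝ) (hP.backwardShift_succ n)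
      have a4 := congrArg (Rat.cast : ℚ → ℝ) (hQ.backwardShift_succ n)
      push_cast at a3 a4 ⊢
      rw [← hldef] at a3 a4
      field_simp
      linear_combination -a3 + Real.pi ^ 2 * a4
    have hz : Tendsto (fun n : ℕ => 1 / (n : ℝ) ^ (k + 1)) atTop (𝓝 0) :=
      (tendsto_const_div_pow (1 : ℝ) _ (by omega)).comp tendsto_natCast_atTop_atTop
    have t := ((hmm.mul hz).div hgrow hc').add_const (Real.pi ^ 2)
    rw [mul_zero, zero_div, zero_add] at t
    refine t.congr' ?_
    filter_upwards [eventually_gt_atTop 0, hgrow.eventually_ne hc'] with n hn hne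
    have hn' : (n : ℝ) ≠ 0 := by positivity
    have hq : (backwardShift u v w k Q n : ℝ) ≠ 0 := fun h0 => hne (by rw [h0, zero_div])
    simp only [Pi.div_apply]
    field_simp
    ring

theorem exists_isPiSqBasis (u v w k : ℕ) : ∃ P Q, IsPiSqBasis u v w k P Q := by
  induction k generalizing v w with
  | zero => exact exists_isPiSqBasis_zero u v w
  | succ k ih =>
    obtain ⟨P, Q, h⟩ := ih (v + 1) (w + 1)
    exact ⟨_, _, isPiSqBasis_backwardShift h⟩

/-! ### From the Hahn equation back to continued fractions -/

theorem eval_familyA (u v w k : ℕ) (x : ℚ) : (familyA u v w k).eval x =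
    2 * x ^ 2 + (3 * u + v + w - 2) * x +
      (k ^ 2 + u ^ 2 + u * k + v * k + w * k + u * v + u * w + v * w + k - u + 1) := by
  simp only [familyA, Polynomial.eval_add, Polynomial.eval_mul, Polynomial.eval_pow,
    Polynomial.eval_X, Polynomial.eval_C, Polynomial.eval_ofNat]

theorem eval_familyB (u v w : ℕ) (x : ℚ) : (familyB u v w).eval x =
    -(x * (x + u) * (x + (u + v)) * (x + (u + w))) := by
  simp only [familyB, Polynomial.eval_add, Polynomial.eval_mul, Polynomial.eval_neg,
    Polynomial.eval_X, Polynomial.eval_C]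

theorem eval_familyA_succ_pos (u v w k n : ℕ) : 0 < (familyA u v w k).eval ((n : ℚ) + 1) := by
  have : (familyA u v w k).eval ((n : ℚ) + 1) =
      2 * n * (n + 1) + (3 * u + v + w) * n + u + u + v + w +
      (k ^ 2 + u ^ 2 + u * k + v * k + w * k + u * v + u * w + v * w + k + 1) := by
    rw [eval_familyA]
    ring
  rw [this]
  positivity

theorem eval_familyB_succ_ne_zero (u v w n : ℕ) : (familyB u v w).eval ((n : ℚ) + 1) ≠ 0 := by
  rw [eval_familyB]
  have : (0 : ℚ) < ((n : ℚ) + 1) * (n + 1 + u) * (n + 1 + (u + v)) * (n + 1 + (u + w)) := by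
    positivity
  exact neg_ne_zero.2 this.ne'

/-- The factor `∏ (j + u + v) (j + u + w)` over `1 ≤ j ≤ n`. -/
def hahnFactor (u v w n : ℕ) : ℚ :=
  ∏ j ∈ Finset.range n, ((j : ℚ) + 1 + u + v) * (j + 1 + u + w)

theorem hahnFactor_ne_zero (u v w n : ℕ) : hahnFactor u v w n ≠ 0 :=
  Finset.prod_ne_zero_iff.2 fun j _ => by positivity

theorem hahnFactor_succ (u v w n : ℕ) : hahnFactor u v w (n + 1) =
    hahnFactor u v w n * (((n : ℚ) + 1 + u + v) * (n + 1 + u + w)) :=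
  Finset.prod_range_succ _ _

theorem IsHahnSol.recurrence {u v w k : ℕ} {x : ℕ → ℚ} (hx : IsHahnSol u v w k x) (n : ℕ) :
    hahnFactor u v w (n + 2) * x (n + 2) =
      (familyA u v w k).eval ((n + 2 : ℕ) : ℚ) * (hahnFactor u v w (n + 1) * x (n + 1)) +
        (familyB u v w).eval ((n + 1 : ℕ) : ℚ) * (hahnFactor u v w n * x n) := by
  have h := hx n
  rw [eval_familyA, eval_familyB, hahnFactor_succ u v w (n + 1), hahnFactor_succ u v w n]
  push_cast
  linear_combination hahnFactor u v w n * (((n : ℚ) + 1 + u + v) * (n + 1 + u + w)) * h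

/-- Two solutions of a recurrence of order two that agree at `N` and `N + 1` agree from `N` on. -/
theorem eq_of_recurrence {y y' A B : ℕ → ℚ} {N : ℕ}
    (hy : ∀ n ≥ N, y (n + 2) = A n * y (n + 1) + B n * y n)
    (hy' : ∀ n ≥ N, y' (n + 2) = A n * y' (n + 1) + B n * y' n)
    (h0 : y N = y' N) (h1 : y (N + 1) = y' (N + 1)) {n : ℕ} (hn : N ≤ n) : y n = y' n := by
  have : ∀ m, y (N + m) = y' (N + m) ∧ y (N + m + 1) = y' (N + m + 1) := by
    intro m
    induction m with
    | zero => exact ⟨h0, h1⟩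
    | succ m ih =>
      refine ⟨ih.2, ?_⟩
      have e : N + (m + 1) + 1 = N + m + 2 := by omega
      rw [e, hy _ (by omega), hy' _ (by omega), ih.1, ih.2]
  obtain ⟨m, rfl⟩ := Nat.exists_eq_add_of_le hn
  exact (this m).1

theorem IsPiSqBasis.exists_eq_combination {u v w k : ℕ} {P Q : ℕ → ℚ}
    (h : IsPiSqBasis u v w k P Q) {y : ℕ → ℚ} {N : ℕ}
    (hy : ∀ n ≥ N, y (n + 2) = (familyA u v w k).eval ((n + 2 : ℕ) : ℚ) * y (n + 1) +
      (familyB u v w).eval ((n + 1 : ℕ) : ℚ) * y n) :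
    ∃ α β : ℚ, ∀ n ≥ N, y n = hahnFactor u v w n * (α * P n + β * Q n) := by
  have hW := h.casoratian_ne_zero N
  have f0 := hahnFactor_ne_zero u v w N
  have f1 := hahnFactor_ne_zero u v w (N + 1)
  set a := y N / hahnFactor u v w N with ha
  set b := y (N + 1) / hahnFactor u v w (N + 1) with hb
  have ya : y N = hahnFactor u v w N * a := by rw [ha]; field_simp
  have yb : y (N + 1) = hahnFactor u v w (N + 1) * b := by rw [hb]; field_simp
  set W := P (N + 1) * Q N - P N * Q (N + 1) with hWdef
  -- Cramer's rule for matching the values at `N` and `N + 1`; its determinant is the Casoratian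
  -- `W`.
  refine ⟨(b * Q N - a * Q (N + 1)) / W, (a * P (N + 1) - b * P N) / W, fun n hn =>
    eq_of_recurrence (y' := fun n => hahnFactor u v w n *
      ((b * Q N - a * Q (N + 1)) / W * P n + (a * P (N + 1) - b * P N) / W * Q n))
      hy (fun m _ => ?_) ?_ ?_ hn⟩
  · linear_combination (b * Q N - a * Q (N + 1)) / W * h.isHahnSol_left.recurrence m +
      (a * P (N + 1) - b * P N) / W * h.isHahnSol_right.recurrence m
  · rw [ya]
    congr 1
    field_simp
    rw [hWdef]
    ring
  · rw [yb]
    congr 1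
    field_simp
    rw [hWdef]
    ring

namespace RatCF

theorem casoratian_ne_zero (c : RatCF) (n : ℕ) : c.p (n + 1) * c.q n - c.p n * c.q (n + 1) ≠ 0 := by
  induction n with
  | zero =>
    rw [zero_add, p_one, q_one, p_zero, q_zero]
    have := c.b_ne_zero 0
    ring_nf
    exact this
  | succ n ih =>
    rw [p_add_two, q_add_two]
    have := mul_ne_zero (neg_ne_zero.2 (c.b_ne_zero (n + 1))) ih
    convert this using 1
    ring

end RatCF

/-- Multiplying all four coefficients by a common denominator leaves the Möbius map unchanged. -/
theorem isMobiusImage_of_rat {z z' : ℝ} {α β γ δ : ℚ} (hdet : α * δ - β * γ ≠ 0)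
    (hden : (γ : ℝ) * z + δ ≠ 0) (hz : z' = ((α : ℝ) * z + β) / ((γ : ℝ) * z + δ)) :
    IsMobiusImage z z' := by
  set D : ℕ := α.den * β.den * γ.den * δ.den with hD
  have hD0 : (D : ℚ) ≠ 0 := by
    rw [hD]
    simp
  have key : ∀ x : ℚ, x.den ∣ D → ∃ t : ℤ, (t : ℚ) = D * x := by
    rintro x ⟨m, hm⟩
    refine ⟨m * x.num, ?_⟩
    rw [hm]
    push_cast
    rw [← Rat.mul_den_eq_num x]
    ring
  obtain ⟨a, ha⟩ := key α ⟨β.den * γ.den * δ.den, by rw [hD]; ring⟩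
  obtain ⟨b, hb⟩ := key β ⟨α.den * γ.den * δ.den, by rw [hD]; ring⟩
  obtain ⟨c, hc⟩ := key γ ⟨α.den * β.den * δ.den, by rw [hD]; ring⟩
  obtain ⟨d, hd⟩ := key δ ⟨α.den * β.den * γ.den, by rw [hD]; ring⟩
  have hDR : (D : ℝ) ≠ 0 := by exact_mod_cast hD0
  have toR : ∀ {x : ℚ} {t : ℤ}, (t : ℚ) = D * x → (t : ℝ) = D * x := fun h => by exact_mod_cast h
  refine ⟨a, b, c, d, ?_, ?_, ?_⟩
  · intro h
    have h' : (a : ℚ) * d - b * c = 0 := by exact_mod_cast h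
    rw [ha, hb, hc, hd] at h'
    have : (D : ℚ) * D * (α * δ - β * γ) = 0 := by linear_combination h'
    exact (mul_ne_zero (mul_ne_zero hD0 hD0) hdet) this
  · rw [toR hc, toR hd, mul_assoc, ← mul_add]
    exact mul_ne_zero hDR hden
  · rw [toR ha, toR hb, toR hc, toR hd, mul_assoc, mul_assoc, ← mul_add, ← mul_add,
      mul_div_mul_left _ _ hDR, hz]

theorem RatCF.hasSpeed_of_tendsto {c : RatCF} {z C : ℝ} {M : ℕ} (hC : C ≠ 0)
    (h : Tendsto (fun n : ℕ => (z - (c.p n : ℝ) / c.q n) * (n : ℝ) ^ M) atTop (𝓝 C)) :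
    c.HasSpeed z M := by
  refine ⟨C, hC, Asymptotics.isEquivalent_of_tendsto_one ?_⟩
  have := h.div_const C
  rw [div_self hC] at this
  refine this.congr fun n => ?_
  simp only [Pi.div_apply]
  rw [div_div_eq_mul_div]

theorem IsPiSqBasis.convergent {u v w k : ℕ} {P Q : ℕ → ℚ} (h : IsPiSqBasis u v w k P Q)
    {c : RatCF} (hc : c.HasTail (familyA u v w k) (familyB u v w)) {z : ℝ}
    (hz : c.ConvergesTo z) :
    IsMobiusImage (Real.pi ^ 2) z ∧ c.HasSpeed z (u + v + w + 2 * k + 1) := by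
  obtain ⟨N, hN⟩ := eventually_atTop.1 hc
  have htail : ∀ n ≥ N, c.a (n + 2) = (familyA u v w k).eval ((n + 2 : ℕ) : ℚ) ∧
      c.b (n + 1) = (familyB u v w).eval ((n + 1 : ℕ) : ℚ) := fun n hn =>
    ⟨(hN (n + 2) (by omega)).1, (hN (n + 1) (by omega)).2⟩
  obtain ⟨α, β, hp⟩ := h.exists_eq_combination (y := c.p) (N := N) fun n hn => by
    rw [RatCF.p_add_two, (htail n hn).1, (htail n hn).2]
  obtain ⟨γ, δ, hq⟩ := h.exists_eq_combination (y := c.q) (N := N) fun n hn => by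
    rw [RatCF.q_add_two, (htail n hn).1, (htail n hn).2]
  have hdet : α * δ - β * γ ≠ 0 := by
    intro h0
    apply c.casoratian_ne_zero N
    rw [hp N le_rfl, hq N le_rfl, hp (N + 1) (by omega), hq (N + 1) (by omega)]
    linear_combination hahnFactor u v w N * hahnFactor u v w (N + 1) *
      (P (N + 1) * Q N - P N * Q (N + 1)) * h0
  have hdetR : (α : ℝ) * δ - β * γ ≠ 0 := by exact_mod_cast hdet
  obtain ⟨hq0, hlim⟩ := hz
  set θ : ℝ := Real.pi ^ 2 with hθ
  have hnum : Tendsto (fun n => (α : ℝ) * ((P n : ℝ) / Q n) + β) atTop (𝓝 (α * θ + β)) :=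
    (h.lim.const_mul _).add_const _
  have hden : Tendsto (fun n => (γ : ℝ) * ((P n : ℝ) / Q n) + δ) atTop (𝓝 (γ * θ + δ)) :=
    (h.lim.const_mul _).add_const _
  have hpq : ∀ᶠ n in atTop, (γ : ℝ) * ((P n : ℝ) / Q n) + δ ≠ 0 ∧
      (c.p n : ℝ) / c.q n =
        ((α : ℝ) * ((P n : ℝ) / Q n) + β) / ((γ : ℝ) * ((P n : ℝ) / Q n) + δ) := by
    filter_upwards [h.eventually_ne_zero, hq0, eventually_ge_atTop N] with n hQ hqn hn
    have hf : (hahnFactor u v w n : ℝ) ≠ 0 := Rat.cast_ne_zero.2 (hahnFactor_ne_zero u v w n)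
    rw [hq n hn] at hqn
    have hqn' : (γ : ℝ) * P n + δ * Q n ≠ 0 := by exact_mod_cast right_ne_zero_of_mul hqn
    have e : (γ : ℝ) * ((P n : ℝ) / Q n) + δ = (γ * P n + δ * Q n) / Q n := by field_simp
    have e' : (α : ℝ) * ((P n : ℝ) / Q n) + β = (α * P n + β * Q n) / Q n := by field_simp
    refine ⟨by rw [e]; exact div_ne_zero hqn' hQ, ?_⟩
    rw [e, e', hp n hn, hq n hn]
    push_cast
    rw [mul_div_mul_left _ _ hf, div_div_div_cancel_right₀ hQ]
  -- Irrationality of `π²` is not needed: if the denominator tended to `0`, convergence of `p / q`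
  -- would force the numerator to `0` as well, against the nonzero determinant.
  have hne : (γ : ℝ) * θ + δ ≠ 0 := by
    intro h0
    have h1 : Tendsto (fun n => (α : ℝ) * ((P n : ℝ) / Q n) + β) atTop (𝓝 (z * 0)) := by
      rw [h0] at hden
      refine (hlim.mul hden).congr' ?_
      filter_upwards [hpq] with n hn
      rw [hn.2, div_mul_cancel₀ _ hn.1]
    have h2 := tendsto_nhds_unique hnum h1
    rw [mul_zero] at h2
    apply hdetR
    linear_combination (α : ℝ) * h0 - γ * h2
  have hzeq : z = ((α : ℝ) * θ + β) / (γ * θ + δ) :=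
    tendsto_nhds_unique hlim ((hnum.div hden hne).congr' (hpq.mono fun n hn => hn.2.symm))
  refine ⟨isMobiusImage_of_rat hdet hne hzeq, ?_⟩
  obtain ⟨C, hC, hspeed⟩ := h.speed
  -- With `r = P n / Q n`, the difference of Möbius images is `-(α δ - β γ) (r - θ) / ((γ θ + δ) (γ
  -- r + δ))`.
  refine RatCF.hasSpeed_of_tendsto (C := -(α * δ - β * γ) * C / ((γ * θ + δ) * (γ * θ + δ))) ?_ ?_
  · exact div_ne_zero (mul_ne_zero (neg_ne_zero.2 hdetR) hC) (mul_ne_zero hne hne)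
  · refine ((hspeed.const_mul (-((α : ℝ) * δ - β * γ))).div (hden.const_mul (γ * θ + δ))
      (mul_ne_zero hne hne)).congr' ?_
    filter_upwards [hpq] with n hn
    obtain ⟨h1, h2⟩ := hn
    rw [h2, hzeq]
    simp only [Pi.div_apply]
    generalize (P n : ℝ) / Q n = r at *
    field_simp
    ring

/-- The continued fraction with `aₙ = A(n)`, `bₙ = B(n)` for `n ≥ 2` and `n ≥ 1` whose convergents
are `P n / Q n`. -/
theorem IsPiSqBasis.represents {u v w k : ℕ} {P Q : ℕ → ℚ} (h : IsPiSqBasis u v w k P Q) :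
    Represents (familyA u v w k) (familyB u v w) (Real.pi ^ 2) := by
  have hQ0 := h.right_zero_ne_zero
  have f0 : hahnFactor u v w 0 = 1 := rfl
  have f1 := hahnFactor_ne_zero u v w 1
  set F := hahnFactor u v w 1 with hF
  -- The terms `a 0`, `a 1`, `b 0` are free. They are solved from the required `p 0`, `p 1`, `q 1`
  -- after scaling by `1 / Q 0`, which is needed because `q 0 = 1`; `b 0` is nonzero by the
  -- Casoratian.
  let c : RatCF :=
    { a := fun n => match n with
        | 0 => P 0 / Q 0
        | 1 => F * Q 1 / Q 0
        | n + 2 => (familyA u v w k).eval ((n + 2 : ℕ) : ℚ)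
      b := fun n => match n with
        | 0 => F * (P 1 * Q 0 - P 0 * Q 1) / (Q 0 * Q 0)
        | n + 1 => (familyB u v w).eval ((n + 1 : ℕ) : ℚ)
      b_ne_zero := fun n => match n with
        | 0 => div_ne_zero (mul_ne_zero f1 (h.casoratian_ne_zero 0)) (mul_ne_zero hQ0 hQ0)
        | n + 1 => by simpa using eval_familyB_succ_ne_zero u v w n
      a_ne_zero := by
        filter_upwards [eventually_ge_atTop 2] with n hn
        obtain ⟨m, rfl⟩ := Nat.exists_eq_add_of_le' hn
        simpa [add_assoc, one_add_one_eq_two] using (eval_familyA_succ_pos u v w k (m + 1)).ne' }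
  have ha : ∀ n, c.a (n + 2) = (familyA u v w k).eval ((n + 2 : ℕ) : ℚ) := fun n => rfl
  have hb : ∀ n, c.b (n + 1) = (familyB u v w).eval ((n + 1 : ℕ) : ℚ) := fun n => rfl
  have hp : ∀ n, c.p n = hahnFactor u v w n * P n / Q 0 := fun n =>
    eq_of_recurrence (N := 0) (y' := fun n => hahnFactor u v w n * P n / Q 0)
      (fun n _ => by rw [c.p_add_two, ha, hb])
      (fun n _ => by
        simp only [h.isHahnSol_left.recurrence n]
        ring)
      (by rw [c.p_zero]; simp only [f0, one_mul]; rfl)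
      (by
        rw [zero_add, c.p_one]
        change F * Q 1 / Q 0 * (P 0 / Q 0) + F * (P 1 * Q 0 - P 0 * Q 1) / (Q 0 * Q 0) * 1 =
          F * P 1 / Q 0
        field_simp
        ring)
      n.zero_le
  have hq : ∀ n, c.q n = hahnFactor u v w n * Q n / Q 0 := fun n =>
    eq_of_recurrence (N := 0) (y' := fun n => hahnFactor u v w n * Q n / Q 0)
      (fun n _ => by rw [c.q_add_two, ha, hb])
      (fun n _ => by
        simp only [h.isHahnSol_right.recurrence n]
        ring)
      (by rw [c.q_zero]; simp only [f0, one_mul]; rw [div_self hQ0])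
      (by
        rw [zero_add, c.q_one]
        change F * Q 1 / Q 0 * 1 + F * (P 1 * Q 0 - P 0 * Q 1) / (Q 0 * Q 0) * 0 = F * Q 1 / Q 0
        ring)
      n.zero_le
  refine ⟨c, ?_, ?_, ?_⟩
  · filter_upwards [eventually_ge_atTop 2] with n hn
    obtain ⟨m, rfl⟩ := Nat.exists_eq_add_of_le' hn
    exact ⟨rfl, rfl⟩
  · filter_upwards [h.eventually_ne_zero] with n hn
    rw [hq]
    exact div_ne_zero (mul_ne_zero (hahnFactor_ne_zero u v w n) (by exact_mod_cast hn)) hQ0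
  · refine h.lim.congr fun n => ?_
    have hf : (hahnFactor u v w n : ℝ) ≠ 0 := Rat.cast_ne_zero.2 (hahnFactor_ne_zero u v w n)
    have hQ0' : (Q 0 : ℝ) ≠ 0 := Rat.cast_ne_zero.2 hQ0
    rw [hp, hq]
    push_cast
    rw [div_div_div_cancel_right₀ hQ0', mul_div_mul_left _ _ hf]

theorem mainTheorem1 (u v w k : ℕ) :
    Represents (familyA u v w k) (familyB u v w) (Real.pi ^ 2) ∧
      ∀ c : RatCF, c.HasTail (familyA u v w k) (familyB u v w) →
        ∀ z : ℝ, c.ConvergesTo z →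
          IsMobiusImage (Real.pi ^ 2) z ∧ c.HasSpeed z (u + v + w + 2 * k + 1) := by
  obtain ⟨P, Q, h⟩ := exists_isPiSqBasis u v w k
  exact ⟨h.represents, fun c hc z hz => h.convergent hc hz⟩
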